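/- Let $\Gamma$ be a countable discrete group. A measure preserving action $\boldsymbol a$ of $\Gamma$ is a Borel action of $\Gamma$ on a standard Borel space $X$ that preserves a Borel probability measure $\mu$ on $X$. Such an action $\boldsymbol a$ on $(X,\mu)$ is weakly contained in a measure preserving action $\boldsymbol b$ of $\Gamma$ on $(Y,\nu)$, written $\boldsymbol a\prec\boldsymbol b$, if for every finite Borel partition $A_0,\dots,A_{k-1}$ of $X$, every finite $F\subseteq\Gamma$ and every $\varepsilon>0$ there is a Borel partition $B_0,\dots,B_{k-1}$ of $Y$ such that $|\mu(\gamma A_i\cap A_j)-\nu(\gamma B_i\cap B_j)|<\varepsilon$ for all $\gamma\in F$ and $0\le i,j<k$ (pieces of partitions may be empty). The actions are weakly equivalent if $\boldsymbol a\prec\boldsymbol b$ and $\boldsymbol b\prec\boldsymbol a$. The action $\boldsymbol b$ is strongly ergodic if every sequence $(A_n)$ of Borel subsets of $Y$ with $\nu(\gamma A_n\,\triangle\,A_n)\to 0$ for all $\gamma\in\Gamma$ satisfies $\nu(A_n)(1-\nu(A_n))\to 0$. It is free if for every $\gamma\ne e$ the set of fixed points of $\gamma$ is null. Let $\boldsymbol\iota$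 denote the trivial (identity) action of $\Gamma$ on a non-atomic standard probability space $(Z,\eta)$; products of actions are taken with the product measure and the diagonal action. **Theorem.** If $\boldsymbol b$ is a strongly ergodic measure preserving action of $\Gamma$, then $\boldsymbol\iota\times\boldsymbol b$ is not weakly equivalent to any ergodic measure preserving action of $\Gamma$. In particular, if $\Gamma$ is non-amenable and $\boldsymbol s_\Gamma$ is the Bernoulli shift action of $\Gamma$ on $([0,1]^\Gamma,\lambda^\Gamma)$, $(\gamma\cdot f)(\delta)=f(\gamma^{-1}\delta)$, where $\lambda$ is Lebesgue measure on $[0,1]$, then $\boldsymbol\iota\times\boldsymbol s_\Gamma$ is a free measure preserving action of $\Gamma$ that is not weakly equivalent to any ergodic measure preserving action of $\Gamma$. -/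

import Mathlib

open MeasureTheory Filter
open scoped Pointwise symmDiff Topology

/-- The action of the group `Γ` on `X` is a measure preserving action on the standard probability
space `(X, μ)`: `X` is a standard Borel space, `μ` is a Borel probability measure, every group
element acts by a Borel map, and `μ` is invariant. (For countable discrete `Γ`, each group element
acting by a Borel map is the same as `Γ × X → X` being Borel.) -/
structure IsMPAction (Γ : Type*) [Group Γ] {X : Type*} [MeasurableSpace X] [MulAction Γ X]
    (μ : Measure X) : Prop where
  standardBorelSpace : StandardBorelSpace X
  isProbabilityMeasure : IsProbabilityMeasure μ
  measurableConstSMul : MeasurableConstSMul Γ X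
  smulInvariantMeasure : SMulInvariantMeasure Γ X μ

/-- `A 0, …, A (k - 1)` is a partition of `X` into Borel sets (some of which may be empty). -/
structure IsBorelPartition {X : Type*} [MeasurableSpace X] {k : ℕ} (A : Fin k → Set X) :
    Prop where
  measurableSet : ∀ i, MeasurableSet (A i)
  disjoint : ∀ i j, i ≠ j → Disjoint (A i) (A j)
  iUnion_eq : ⋃ i, A i = Set.univ

/-- Weak containment `a ≺ b` of the action `a` of `Γ` on `(X, μ)` in the action `b` of `Γ` on
`(Y, ν)`. -/
def WeaklyContained (Γ : Type*) [Group Γ] {X Y : Type*}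
    [MeasurableSpace X] [MulAction Γ X] (μ : Measure X)
    [MeasurableSpace Y] [MulAction Γ Y] (ν : Measure Y) : Prop :=
  ∀ (k : ℕ) (A : Fin k → Set X), IsBorelPartition A → ∀ (F : Finset Γ) (ε : ℝ), 0 < ε →
    ∃ B : Fin k → Set Y, IsBorelPartition B ∧
      ∀ γ ∈ F, ∀ i j : Fin k,
        |μ.real ((γ • A i) ∩ A j) - ν.real ((γ • B i) ∩ B j)| < ε

/-- Weak equivalence `a ∼ b`: each action is weakly contained in the other. -/
def WeaklyEquivalent (Γ : Type*) [Group Γ] {X Y : Type*}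
    [MeasurableSpace X] [MulAction Γ X] (μ : Measure X)
    [MeasurableSpace Y] [MulAction Γ Y] (ν : Measure Y) : Prop :=
  WeaklyContained Γ μ ν ∧ WeaklyContained Γ ν μ

/-- Strong ergodicity: every asymptotically invariant sequence of Borel sets is trivial, i.e. if
`μ (γ A_n ∆ A_n) → 0` for every `γ`, then `μ (A_n) (1 - μ (A_n)) → 0`. -/
def IsStronglyErgodic (Γ : Type*) [Group Γ] {X : Type*} [MeasurableSpace X] [MulAction Γ X]
    (μ : Measure X) : Prop :=
  ∀ A : ℕ → Set X, (∀ n, MeasurableSet (A n)) →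
    (∀ γ : Γ, Tendsto (fun n => μ.real ((γ • A n) ∆ A n)) atTop (𝓝 0)) →
    Tendsto (fun n => μ.real (A n) * (1 - μ.real (A n))) atTop (𝓝 0)

/-- A measure preserving action is free if every `γ ≠ 1` has a null set of fixed points. -/
def IsFreeAction (Γ : Type*) [Group Γ] {X : Type*} [MeasurableSpace X] [MulAction Γ X]
    (μ : Measure X) : Prop :=
  ∀ γ : Γ, γ ≠ 1 → ∀ᵐ x ∂μ, γ • x ≠ x

/-- Amenability of a discrete group: there is a left-invariant finitely additive probability
measure defined on all subsets of the group. -/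
def IsAmenableGroup (Γ : Type*) [Group Γ] : Prop :=
  ∃ m : Set Γ → ℝ, (∀ A, 0 ≤ m A) ∧ m Set.univ = 1 ∧
    (∀ A B, Disjoint A B → m (A ∪ B) = m A + m B) ∧
    ∀ (γ : Γ) (A : Set Γ), m (γ • A) = m A

/-- A copy of the space `Z`, carrying the trivial (identity) action of every group. -/
def TrivialActionSpace (Z : Type*) : Type _ := Z

instance (Z : Type*) [MeasurableSpace Z] : MeasurableSpace (TrivialActionSpace Z) :=
  inferInstanceAs (MeasurableSpace Z)

instance (Γ Z : Type*) [Group Γ] : MulAction Γ (TrivialActionSpace Z) where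
  smul _ z := z
  one_smul _ := rfl
  mul_smul _ _ _ := rfl

/-- The measure `η`, seen on the copy of `Z` with the trivial action. -/
def iotaMeasure {Z : Type*} [MeasurableSpace Z] (η : Measure Z) :
    Measure (TrivialActionSpace Z) := η

/-- The space `[0,1]^Γ` underlying the Bernoulli shift of `Γ`. -/
def BernoulliSpace (Γ : Type*) : Type _ := Γ → unitInterval

instance (Γ : Type*) : MeasurableSpace (BernoulliSpace Γ) :=
  inferInstanceAs (MeasurableSpace (Γ → unitInterval))

/-- The shift action `(γ • f) δ = f (γ⁻¹ δ)`. -/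
instance (Γ : Type*) [Group Γ] : MulAction Γ (BernoulliSpace Γ) where
  smul γ f := fun δ => f (γ⁻¹ * δ)
  one_smul f := funext fun δ => congrArg f (by simp)
  mul_smul γ₁ γ₂ f := funext fun δ => congrArg f (by simp [mul_assoc])

/-- The product measure `λ^Γ` on `[0,1]^Γ`, where `λ` is Lebesgue measure on `[0,1]`. -/
noncomputable def bernoulliShiftMeasure (Γ : Type*) : Measure (BernoulliSpace Γ) :=
  Measure.infinitePi (fun _ : Γ => (volume : Measure unitInterval))

/-! Suppose `ι × b` is weakly equivalent to an ergodic action `a`. An invariant set `C × Y` of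
measure 1/2 is simulated by an almost invariant `A` in `a`, which in turn is simulated by some `B`
in `ι × b`. Two properties of `B` conflict. Let `p z` be the mass of its fibre at `z`. Almost
invariance and strong ergodicity of `b` force `p` to be nearly `{0, 1}`-valued, so `∫ p (1 - p)` is
small (`integral_fibre_mul_one_sub_le`). Ergodicity of `a` gives a convex average of translates of
`A` with squared norm close to `μ(A)²` (`exists_convex_weights_of_ergodicSMul`). This involves
finitely many correlations, so it passes to `B`; Cauchy–Schwarz on fibres
(`sq_measureReal_le_weighted_sum`) then bounds `∫ p²` by about 1/4, while `∫ p` is about 1/2.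

For the Bernoulli shift, the group permutes an orthonormal basis of `L²` made of products of
cosines. Spreading the squared Fourier coefficients of a set over the supports of the basis elements
gives a finitely additive measure on `Γ`, equivariant in the set and of total mass `μ(A)(1 - μ(A))`.
Along a nontrivial asymptotically invariant sequence, the normalised masses converge along an
ultrafilter to an invariant mean, so non-amenability gives strong ergodicity. -/

/-! ### Sets of measure one half; fibres of product measures. -/

/-- Transported to the line, an atomless measure has a continuous distribution function, which takes
the value 1/2. -/
theorem exists_measurableSet_measureReal_eq_half (Z : Type*) [MeasurableSpace Z]
    [StandardBorelSpace Z] (η : Measure Z) [IsProbabilityMeasure η] [NullSingletonClass η] :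
    ∃ C : Set Z, MeasurableSet C ∧ η.real C = 1 / 2 := by
  obtain ⟨f, hf⟩ := exists_measurableEmbedding_real Z
  have : IsProbabilityMeasure (η.map f) := Measure.isProbabilityMeasure_map hf.measurable.aemeasurable
  have hsing : ∀ x, (η.map f) {x} = 0 := fun x => by
    rw [hf.map_apply]
    exact (Set.subsingleton_singleton.preimage hf.injective).measure_zero η
  set F := ProbabilityTheory.cdf (η.map f)
  have hF : F.measure = η.map f := ProbabilityTheory.measure_cdf _
  have hcont : Continuous F := by
    rw [continuous_iff_continuousAt]
    intro x
    rw [F.mono.continuousAt_iff_leftLim_eq_rightLim, F.rightLim_eq]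
    have h := hsing x
    rw [← hF, F.measure_singleton, ENNReal.ofReal_eq_zero] at h
    exact le_antisymm (F.mono.leftLim_le le_rfl) (by linarith)
  obtain ⟨x, hx⟩ : ∃ x, F x = 1 / 2 := by
    have h0 := ProbabilityTheory.tendsto_cdf_atBot (η.map f)
    have h1 := ProbabilityTheory.tendsto_cdf_atTop (η.map f)
    obtain ⟨a, ha⟩ := (h0.eventually_lt_const (by norm_num : (0 : ℝ) < 1 / 2)).exists
    obtain ⟨b, hb⟩ := (h1.eventually_const_lt (by norm_num : (1 / 2 : ℝ) < 1)).exists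
    exact mem_range_of_exists_le_of_exists_ge hcont ⟨a, ha.le⟩ ⟨b, hb.le⟩
  refine ⟨f ⁻¹' Set.Iic x, hf.measurable measurableSet_Iic, ?_⟩
  rw [← hx, ProbabilityTheory.cdf_eq_real, measureReal_def, measureReal_def, hf.map_apply]

theorem measureReal_prod_eq_integral {Z Y : Type*} [MeasurableSpace Z] [MeasurableSpace Y]
    (η : Measure Z) (ν : Measure Y) [IsProbabilityMeasure η] [IsProbabilityMeasure ν]
    {S : Set (Z × Y)} (hS : MeasurableSet S) :
    (η.prod ν).real S = ∫ z, ν.real (Prod.mk z ⁻¹' S) ∂η := by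
  simp only [measureReal_def]
  rw [Measure.prod_apply hS, integral_toReal (measurable_measure_prodMk_left hS).aemeasurable
    (.of_forall fun _ => measure_lt_top _ _)]

theorem integrable_measureReal_fibre {Z Y : Type*} [MeasurableSpace Z] [MeasurableSpace Y]
    (η : Measure Z) (ν : Measure Y) [IsProbabilityMeasure η] [IsProbabilityMeasure ν]
    {S : Set (Z × Y)} (hS : MeasurableSet S) :
    Integrable (fun z => ν.real (Prod.mk z ⁻¹' S)) η := by
  refine Integrable.of_bound (C := 1)
    (measurable_measure_prodMk_left hS).ennreal_toReal.aestronglyMeasurable (.of_forall fun z => ?_)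
  rw [Real.norm_of_nonneg measureReal_nonneg]
  exact measureReal_le_one

/-! ### Uniform strong ergodicity and averages of translates. -/

/-- The sequential definition becomes uniform by contradiction: exhaust the countable group by
finite sets and take counterexamples with `δ = 1 / (n + 1)`. -/
theorem exists_invariance_of_isStronglyErgodic {Γ : Type*} [Group Γ] [Countable Γ] {Y : Type*}
    [MeasurableSpace Y] [MulAction Γ Y] {ν : Measure Y} [IsProbabilityMeasure ν]
    (h : IsStronglyErgodic Γ ν) {ε : ℝ} (hε : 0 < ε) :
    ∃ (F : Finset Γ) (δ : ℝ), 0 < δ ∧ ∀ B : Set Y, MeasurableSet B →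
      (∀ γ ∈ F, ν.real ((γ • B) ∆ B) < δ) → ν.real B * (1 - ν.real B) < ε := by
  classical
  by_contra! hcon
  obtain ⟨e, he⟩ := exists_surjective_nat Γ
  choose B hB hinv hlarge using fun n : ℕ =>
    hcon ((Finset.range n).image e) (1 / (n + 1 : ℝ)) (by positivity)
  have := h B hB fun γ => by
    obtain ⟨k, rfl⟩ := he γ
    refine squeeze_zero' (.of_forall fun _ => measureReal_nonneg) ?_
      tendsto_one_div_add_atTop_nhds_zero_nat
    filter_upwards [eventually_gt_atTop k] with n hn
    exact (hinv n _ (Finset.mem_image_of_mem e (Finset.mem_range.2 hn))).le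
  obtain ⟨n, hn⟩ := (this.eventually_lt_const hε).exists
  exact (hlarge n).not_gt hn

-- Mean ergodic theorem by convexity: the element of least norm in the closed convex hull of the
-- translates of `1_A` is invariant, hence constant, hence equal to `μ(A)`. A true convex
-- combination close to it supplies the weights.
open scoped RealInnerProductSpace in
theorem exists_convex_weights_of_ergodicSMul {Γ : Type*} [Group Γ] [Countable Γ] {X : Type*}
    [MeasurableSpace X] [MulAction Γ X] {μ : Measure X} [IsProbabilityMeasure μ]
    [MeasurableConstSMul Γ X] [ErgodicSMul Γ X μ] {A : Set X} (hA : MeasurableSet A)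
    {ε : ℝ} (hε : 0 < ε) :
    ∃ (ι : Type) (_ : Fintype ι) (w : ι → ℝ) (g : ι → Γ), (∀ i, 0 ≤ w i) ∧ ∑ i, w i = 1 ∧
      ∑ i, ∑ j, w i * w j * μ.real (g i • A ∩ g j • A) < μ.real A ^ 2 + ε := by
  let v : Γ → Lp ℝ 2 μ := fun γ =>
    indicatorConstLp 2 (hA.const_smul γ) (measure_ne_top μ _) (1 : ℝ)
  let one : Lp ℝ 2 μ := indicatorConstLp 2 MeasurableSet.univ (measure_ne_top μ _) (1 : ℝ)
  set K : Set (Lp ℝ 2 μ) := closure (convexHull ℝ (Set.range v))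
  have hKconv : Convex ℝ K := (convex_convexHull ℝ _).closure
  have hvK : ∀ γ, v γ ∈ K := fun γ => subset_closure (subset_convexHull _ _ ⟨γ, rfl⟩)
  obtain ⟨u, huK, hu⟩ := exists_norm_eq_iInf_of_complete_convex ⟨_, hvK 1⟩
    isClosed_closure.isComplete hKconv 0
  -- the elements of `K` have mean `μ A`
  have hmean : ∀ x ∈ K, ⟪one, x⟫ = μ.real A := by
    have hcl : IsClosed {x : Lp ℝ 2 μ | ⟪one, x⟫ = μ.real A} :=
      isClosed_eq (by fun_prop) continuous_const
    have hcv : Convex ℝ {x : Lp ℝ 2 μ | ⟪one, x⟫ = μ.real A} :=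
      convex_hyperplane (innerₛₗ ℝ one).isLinear _
    refine closure_minimal (convexHull_min ?_ hcv) hcl
    rintro _ ⟨γ, rfl⟩
    change ⟪one, v γ⟫ = μ.real A
    simp only [one, v, L2.real_inner_indicatorConstLp_one_indicatorConstLp_one,
      Set.univ_inter, measureReal_def, measure_smul]
  -- `K` is invariant
  have hsmulv : ∀ c γ : Γ, DomMulAct.mk c • v γ = v (c⁻¹ * γ) := fun c γ => by
    simp only [v, DomMulAct.mk_smul_indicatorConstLp]
    congr 1
    rw [Set.preimage_smul, mul_smul]
  have hsmulK : ∀ c : Γ, ∀ x ∈ K, DomMulAct.mk c • x ∈ K := by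
    intro c
    let T : Lp ℝ 2 μ →ₗ[ℝ] Lp ℝ 2 μ :=
      { toFun := fun x => DomMulAct.mk c • x
        map_add' := smul_add _
        map_smul' := fun r x => smul_comm _ _ _ }
    have hTc : Continuous T := (isometry_smul (Lp ℝ 2 μ) (DomMulAct.mk c)).continuous
    intro x hx
    refine map_mem_closure (f := T) hTc hx fun y hy => ?_
    have : T y ∈ T '' convexHull ℝ (Set.range v) := ⟨y, hy, rfl⟩
    rw [T.image_convexHull] at this
    refine convexHull_mono ?_ this
    rintro _ ⟨_, ⟨γ, rfl⟩, rfl⟩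
    exact ⟨c⁻¹ * γ, (hsmulv c γ).symm⟩
  -- Both `u` and its translate minimise the norm on `K`; adding their two variational inequalities
  -- gives `‖c • u - u‖² ≤ 0`.
  have hfix : ∀ c : Γ, DomMulAct.mk c • u = u := by
    intro c
    have hcK := hsmulK c u huK
    have h1 := (norm_eq_iInf_iff_real_inner_le_zero hKconv huK).1 hu _ hcK
    have h2 := (norm_eq_iInf_iff_real_inner_le_zero hKconv hcK).1
      (by rw [← hu, zero_sub, zero_sub, norm_neg, norm_neg, DomMulAct.norm_smul_Lp]) _ huK
    have h3 : ⟪DomMulAct.mk c • u - u, DomMulAct.mk c • u - u⟫ ≤ 0 := by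
      simp only [zero_sub, inner_sub_left, inner_sub_right, inner_neg_left] at h1 h2 ⊢
      linarith
    rw [real_inner_self_eq_norm_sq] at h3
    exact sub_eq_zero.1 (norm_eq_zero.1 (pow_eq_zero_iff two_ne_zero |>.1
      (le_antisymm h3 (sq_nonneg _))))
  have hconst : ∃ a : ℝ, u =ᵐ[μ] Function.const X a := by
    -- Preimages of measurable sets under `u` are almost invariant, hence null or conull, and these
    -- sets separate the points of `ℝ`.
    refine exists_eventuallyEq_const_of_forall_separating MeasurableSet fun U hU => ?_
    have hmeas : NullMeasurableSet (u ⁻¹' U) μ :=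
      (Lp.aestronglyMeasurable u).aemeasurable.nullMeasurable hU
    have := aeconst_of_forall_preimage_smul_ae_eq Γ hmeas fun c => by
      have h := DomMulAct.smul_Lp_ae_eq (DomMulAct.mk c) u
      rw [hfix c] at h
      filter_upwards [h] with x hx
      change (u (c • x) ∈ U) = (u x ∈ U)
      rw [hx]; rfl
    exact eventuallyConst_set.1 this
  obtain ⟨a, ha⟩ := hconst
  have hua : u = a • one := by
    refine Lp.ext ?_
    filter_upwards [ha, Lp.coeFn_smul a one,
      indicatorConstLp_coeFn (p := 2) (hs := MeasurableSet.univ) (hμs := measure_ne_top μ _)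
        (c := (1 : ℝ))] with x h1 h2 h3
    rw [h1, h2, Pi.smul_apply, h3]
    simp
  have hone : ⟪one, one⟫ = 1 := by
    simp only [one, L2.real_inner_indicatorConstLp_one_indicatorConstLp_one, Set.inter_self,
      probReal_univ]
  have haA : a = μ.real A := by
    rw [← hmean u huK, hua, inner_smul_right, hone, mul_one]
  have hnorm : ⟪u, u⟫ = μ.real A ^ 2 := by
    rw [hua, inner_smul_left, inner_smul_right, hone, haA]
    simp [sq]
  have hopen : IsOpen {x : Lp ℝ 2 μ | ⟪x, x⟫ < μ.real A ^ 2 + ε} :=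
    isOpen_lt (by fun_prop) continuous_const
  obtain ⟨y, hy, hyc⟩ := mem_closure_iff.1 huK _ hopen
    (show ⟪u, u⟫ < _ by rw [hnorm]; linarith)
  obtain ⟨ι, hι, w, z, hw, hw1, hz, rfl⟩ := mem_convexHull_iff_exists_fintype.1 hyc
  choose g hg using hz
  refine ⟨ι, hι, w, g, hw, hw1, ?_⟩
  have hyy : ⟪∑ i, w i • z i, ∑ i, w i • z i⟫ < μ.real A ^ 2 + ε := hy
  refine lt_of_eq_of_lt ?_ hyy
  simp only [sum_inner, inner_sum, inner_smul_left, inner_smul_right, ← hg, v,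
    L2.real_inner_indicatorConstLp_one_indicatorConstLp_one,
    conj_trivial]
  refine Finset.sum_congr rfl fun i _ => ?_
  rw [Finset.mul_sum]
  refine Finset.sum_congr rfl fun j _ => ?_
  rw [Set.inter_comm]
  ring

-- Cauchy–Schwarz for the weighted sum of translated indicators against the constant 1. No
-- ergodicity is needed, so it applies on every fibre.
open scoped RealInnerProductSpace in
theorem sq_measureReal_le_weighted_sum {Γ : Type*} [Group Γ] {Y : Type*}
    [MeasurableSpace Y] [MulAction Γ Y] {ν : Measure Y} [IsProbabilityMeasure ν]
    [MeasurableConstSMul Γ Y] [SMulInvariantMeasure Γ Y ν] {B : Set Y} (hB : MeasurableSet B)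
    {ι : Type*} [Fintype ι] {w : ι → ℝ} (g : ι → Γ) (hw : ∑ i, w i = 1) :
    ν.real B ^ 2 ≤ ∑ i, ∑ j, w i * w j * ν.real (g i • B ∩ g j • B) := by
  let v : Γ → Lp ℝ 2 ν := fun γ =>
    indicatorConstLp 2 (hB.const_smul γ) (measure_ne_top ν _) (1 : ℝ)
  let one : Lp ℝ 2 ν := indicatorConstLp 2 MeasurableSet.univ (measure_ne_top ν _) (1 : ℝ)
  have h1 : ⟪one, ∑ i, w i • v (g i)⟫ = ν.real B := by
    simp only [inner_sum, inner_smul_right, one, v,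
      L2.real_inner_indicatorConstLp_one_indicatorConstLp_one, Set.univ_inter]
    simp only [measureReal_def, measure_smul]
    rw [← Finset.sum_mul, hw, one_mul]
  have h2 : ⟪one, one⟫ = 1 := by
    simp only [one, L2.real_inner_indicatorConstLp_one_indicatorConstLp_one, Set.inter_self,
      probReal_univ]
  have h3 : ⟪∑ i, w i • v (g i), ∑ i, w i • v (g i)⟫
      = ∑ i, ∑ j, w i * w j * ν.real (g i • B ∩ g j • B) := by
    simp only [sum_inner, inner_sum, inner_smul_left, inner_smul_right, v,
      L2.real_inner_indicatorConstLp_one_indicatorConstLp_one, conj_trivial]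
    refine Finset.sum_congr rfl fun i _ => ?_
    rw [Finset.mul_sum]
    refine Finset.sum_congr rfl fun j _ => ?_
    rw [Set.inter_comm]
    ring
  have h4 := real_inner_mul_inner_self_le one (∑ i, w i • v (g i))
  rw [h1, h2, h3, one_mul] at h4
  rwa [sq]

/-! ### Weak containment tested on a set and its complement. -/

theorem isBorelPartition_compl {X : Type*} [MeasurableSpace X] {A : Set X} (hA : MeasurableSet A) :
    IsBorelPartition ![A, Aᶜ] where
  measurableSet i := by
    fin_cases i
    exacts [hA, hA.compl]
  disjoint i j hij := by
    fin_cases i <;> fin_cases j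
    · exact absurd rfl hij
    · exact disjoint_compl_right
    · exact disjoint_compl_left
    · exact absurd rfl hij
  iUnion_eq := by
    rw [← Set.union_compl_self A]
    ext x
    simp [Fin.exists_fin_two, em]

theorem IsBorelPartition.eq_compl {X : Type*} [MeasurableSpace X] {B : Fin 2 → Set X}
    (hB : IsBorelPartition B) : B 1 = (B 0)ᶜ := by
  refine (IsCompl.compl_eq ⟨hB.disjoint 0 1 (by decide), ?_⟩).symm
  rw [codisjoint_iff_le_sup]
  intro x _
  have hx : x ∈ ⋃ i, B i := hB.iUnion_eq ▸ Set.mem_univ x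
  simpa [Fin.exists_fin_two] using hx

theorem measureReal_smul_symmDiff {Γ : Type*} [Group Γ] {X : Type*} [MeasurableSpace X]
    [MulAction Γ X] {μ : Measure X} [IsFiniteMeasure μ] [MeasurableConstSMul Γ X]
    {A : Set X} (hA : MeasurableSet A) (γ : Γ) :
    μ.real ((γ • A) ∆ A) = μ.real (γ • A ∩ Aᶜ) + μ.real (γ • Aᶜ ∩ A) := by
  rw [Set.symmDiff_def, measureReal_union disjoint_sdiff_sdiff (hA.diff (hA.const_smul γ)),
    Set.sdiff_eq, Set.sdiff_eq, Set.smul_set_compl, Set.inter_comm A]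

theorem WeaklyContained.exists_measurableSet {Γ : Type*} [Group Γ] {X Y : Type*}
    [MeasurableSpace X] [MulAction Γ X] [MeasurableConstSMul Γ X]
    {μ : Measure X} [IsFiniteMeasure μ]
    [MeasurableSpace Y] [MulAction Γ Y] [MeasurableConstSMul Γ Y]
    {ν : Measure Y} [IsFiniteMeasure ν] (h : WeaklyContained Γ μ ν)
    {A : Set X} (hA : MeasurableSet A) (F : Finset Γ) {ε : ℝ} (hε : 0 < ε) :
    ∃ B : Set Y, MeasurableSet B ∧ |μ.real A - ν.real B| < ε ∧
      ∀ γ ∈ F, |μ.real (γ • A ∩ A) - ν.real (γ • B ∩ B)| < ε ∧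
        |μ.real ((γ • A) ∆ A) - ν.real ((γ • B) ∆ B)| < ε := by
  classical
  -- The identity is added to `F` to control the measure of the set itself; `ε / 2` because a
  -- symmetric difference uses two entries of the correlation matrix.
  obtain ⟨B, hB, hF⟩ := h 2 _ (isBorelPartition_compl hA) (insert 1 F) (ε / 2) (half_pos hε)
  refine ⟨B 0, hB.measurableSet 0, ?_, fun γ hγ => ⟨?_, ?_⟩⟩
  · have := hF 1 (Finset.mem_insert_self _ _) 0 0
    simp only [one_smul, Set.inter_self, Matrix.cons_val_zero] at this
    linarith
  · have := hF γ (Finset.mem_insert_of_mem hγ) 0 0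
    simp only [Matrix.cons_val_zero] at this
    linarith
  · rw [measureReal_smul_symmDiff hA, measureReal_smul_symmDiff (hB.measurableSet 0)]
    have h1 := hF γ (Finset.mem_insert_of_mem hγ) 0 1
    have h2 := hF γ (Finset.mem_insert_of_mem hγ) 1 0
    simp only [Matrix.cons_val_zero, Matrix.cons_val_one, hB.eq_compl] at h1 h2
    rw [abs_lt] at *
    constructor <;> linarith

/-! ### Products with the trivial action. -/

instance {Γ Z Y : Type*} [Group Γ] [MeasurableSpace Z] [MeasurableSpace Y] [MulAction Γ Y]
    [MeasurableConstSMul Γ Y] : MeasurableConstSMul Γ (TrivialActionSpace Z × Y) where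
  measurable_const_smul γ :=
    (measurable_fst (α := TrivialActionSpace Z) (β := Y)).prodMk
      (measurable_snd.const_smul γ)

theorem prodMk_preimage_smul_trivial {Γ Z Y : Type*} [Group Γ] [MulAction Γ Y] (γ : Γ)
    (B : Set (TrivialActionSpace Z × Y)) (z : TrivialActionSpace Z) :
    Prod.mk z ⁻¹' (γ • B) = γ • (Prod.mk z ⁻¹' B) := by
  ext y
  simp only [Set.mem_preimage, Set.mem_smul_set_iff_inv_smul_mem]
  rfl

instance {Z : Type*} [MeasurableSpace Z] (η : Measure Z) [IsProbabilityMeasure η] :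
    IsProbabilityMeasure (iotaMeasure η) := inferInstanceAs (IsProbabilityMeasure η)

/-- The fibrewise mass `z ↦ ν (B_z)` of an almost invariant subset `B` of a product of a trivial
action and a strongly ergodic action is almost `{0, 1}`-valued. -/
theorem integral_fibre_mul_one_sub_le {Γ Z Y : Type*} [Group Γ] [MeasurableSpace Z]
    [MeasurableSpace Y] [MulAction Γ Y] [MeasurableConstSMul Γ Y] {η : Measure Z}
    [IsProbabilityMeasure η] {ν : Measure Y} [IsProbabilityMeasure ν]
    {F : Finset Γ} {δ ε : ℝ} (hδ : 0 < δ) (hε : 0 < ε)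
    (hF : ∀ B : Set Y, MeasurableSet B →
      (∀ γ ∈ F, ν.real ((γ • B) ∆ B) < δ) → ν.real B * (1 - ν.real B) < ε)
    {B : Set (TrivialActionSpace Z × Y)} (hB : MeasurableSet B) :
    ∫ z, ν.real (Prod.mk z ⁻¹' B) * (1 - ν.real (Prod.mk z ⁻¹' B)) ∂(iotaMeasure η) ≤
      ε + ∑ γ ∈ F, ((iotaMeasure η).prod ν).real ((γ • B) ∆ B) / δ := by
  have hms : ∀ γ : Γ, MeasurableSet ((γ • B) ∆ B) := fun γ => (hB.const_smul γ).symmDiff hB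
  have hpt : ∀ z, ν.real (Prod.mk z ⁻¹' B) * (1 - ν.real (Prod.mk z ⁻¹' B)) ≤
      ε + ∑ γ ∈ F, ν.real (Prod.mk z ⁻¹' ((γ • B) ∆ B)) / δ := by
    intro z
    have hnn : ∀ γ ∈ F, 0 ≤ ν.real (Prod.mk z ⁻¹' ((γ • B) ∆ B)) / δ := fun γ _ => by positivity
    have hfib : ∀ γ : Γ, Prod.mk z ⁻¹' ((γ • B) ∆ B) =
        (γ • (Prod.mk z ⁻¹' B)) ∆ (Prod.mk z ⁻¹' B) := fun γ => by
      rw [← prodMk_preimage_smul_trivial]; rfl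
    -- Markov-type dichotomy: either the fibre is `δ`-invariant and `hF` applies, or one term of the
    -- sum is already at least 1, which exceeds `p (1 - p)`.
    by_cases hz : ∀ γ ∈ F, ν.real ((γ • (Prod.mk z ⁻¹' B)) ∆ (Prod.mk z ⁻¹' B)) < δ
    · have := hF _ (measurable_prodMk_left hB) hz
      have := Finset.sum_nonneg hnn
      linarith
    · push Not at hz
      obtain ⟨γ, hγ, hge⟩ := hz
      rw [← hfib] at hge
      have h1 := Finset.single_le_sum hnn hγ
      have h2 : 1 ≤ ν.real (Prod.mk z ⁻¹' ((γ • B) ∆ B)) / δ := (one_le_div hδ).2 hge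
      have h3 : (0 : ℝ) ≤ ν.real (Prod.mk z ⁻¹' B) := measureReal_nonneg
      have h4 : ν.real (Prod.mk z ⁻¹' B) ≤ 1 := measureReal_le_one
      nlinarith
  have hint : ∀ γ ∈ F, Integrable (fun z => ν.real (Prod.mk z ⁻¹' ((γ • B) ∆ B)) / δ)
      (iotaMeasure η) := fun γ _ => (integrable_measureReal_fibre _ ν (hms γ)).div_const δ
  have hp := integrable_measureReal_fibre (iotaMeasure η) ν hB
  refine (integral_mono_of_nonneg (.of_forall fun z => ?_)
    ((integrable_const ε).add (integrable_finsetSum F hint)) (.of_forall hpt)).trans ?_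
  · exact mul_nonneg measureReal_nonneg (sub_nonneg.2 measureReal_le_one)
  · simp only [Pi.add_apply]
    rw [integral_add (integrable_const ε) (integrable_finsetSum F hint), integral_finsetSum F hint]
    simp only [integral_const, probReal_univ, one_smul]
    gcongr with γ hγ
    rw [integral_div, measureReal_prod_eq_integral _ _ (hms γ)]

/-! ### Incompatibility with ergodic actions. -/

theorem not_weaklyEquivalent_of_isStronglyErgodic {Γ : Type*} [Group Γ] [Countable Γ]
    {Z : Type*} [MeasurableSpace Z] [StandardBorelSpace Z]
    (η : Measure Z) [IsProbabilityMeasure η] [NullSingletonClass η]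
    {Y : Type*} [MeasurableSpace Y] [MulAction Γ Y] {ν : Measure Y}
    (hν : IsMPAction Γ ν) (hse : IsStronglyErgodic Γ ν)
    {X : Type*} [MeasurableSpace X] [MulAction Γ X] {μ : Measure X}
    (hμ : IsMPAction Γ μ) (herg : ErgodicSMul Γ X μ) :
    ¬ WeaklyEquivalent Γ ((iotaMeasure η).prod ν) μ := by
  classical
  rintro ⟨hle, hge⟩
  have := hν.isProbabilityMeasure
  have := hν.measurableConstSMul
  have := hν.smulInvariantMeasure
  have := hμ.isProbabilityMeasure
  have := hμ.measurableConstSMul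
  obtain ⟨F, δ, hδ, hF⟩ := exists_invariance_of_isStronglyErgodic hse
    (by norm_num : (0 : ℝ) < 1 / 100)
  -- Each of the two weak containments costs `t`, so `γ • B ∆ B` will have measure below `2 * t`;
  -- the second bound keeps the sum over `F` of these measures divided by `δ` at most 1/50.
  set t : ℝ := min (1 / 100) (δ / (100 * (F.card + 1)))
  have ht : 0 < t := by positivity
  have ht1 : t ≤ 1 / 100 := min_le_left _ _
  have ht2 : F.card * (2 * t / δ) ≤ 1 / 50 := by
    have h : t ≤ δ / (100 * (F.card + 1)) := min_le_right _ _
    rw [le_div_iff₀ (by positivity)] at h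
    rw [← mul_div_assoc, div_le_iff₀ hδ]
    nlinarith
  -- an almost invariant set of measure close to `1 / 2` for the ergodic action
  obtain ⟨C, hC, hCη⟩ := exists_measurableSet_measureReal_eq_half Z η
  let C' : Set (TrivialActionSpace Z) := C
  have hCm : MeasurableSet (C' ×ˢ (Set.univ : Set Y)) := MeasurableSet.prod hC MeasurableSet.univ
  have hCinv : ∀ γ : Γ, γ • (C' ×ˢ (Set.univ : Set Y)) = C' ×ˢ Set.univ := fun γ => by
    ext ⟨z, y⟩
    rw [Set.mem_smul_set_iff_inv_smul_mem]
    simp only [Set.mem_prod, Set.mem_univ, and_true]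
    rfl
  have hCmeas : ((iotaMeasure η).prod ν).real (C' ×ˢ (Set.univ : Set Y)) = 1 / 2 := by
    rw [measureReal_prod_prod, probReal_univ, mul_one]
    exact hCη
  obtain ⟨A, hA, hA1, hA2⟩ := hle.exists_measurableSet hCm F ht
  rw [hCmeas] at hA1
  -- averages of translates of `A` are almost constant
  obtain ⟨ι, _, w, g, hw, hw1, hsum⟩ := exists_convex_weights_of_ergodicSMul (Γ := Γ) (μ := μ) hA
    (by norm_num : (0 : ℝ) < 1 / 100)
  -- By invariance, the correlation of the translates by `g i` and `g j` is that of the translate by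
  -- `(g j)⁻¹ * g i` with the set itself, the only kind that weak containment controls.
  obtain ⟨B, hB, hB1, hB2⟩ := hge.exists_measurableSet hA
    (F ∪ Finset.univ.image fun p : ι × ι => (g p.2)⁻¹ * g p.1) ht
  set κ := (iotaMeasure η).prod ν
  have hp := integrable_measureReal_fibre (iotaMeasure η) ν hB
  set p : TrivialActionSpace Z → ℝ := fun z => ν.real (Prod.mk z ⁻¹' B)
  have hp2 : Integrable (fun z => p z ^ 2) (iotaMeasure η) := by
    refine Integrable.of_bound (C := 1) (hp.aestronglyMeasurable.pow 2) (.of_forall fun z => ?_)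
    rw [Real.norm_of_nonneg (sq_nonneg _)]
    exact pow_le_one₀ measureReal_nonneg measureReal_le_one
  have hκB : κ.real B = ∫ z, p z ∂(iotaMeasure η) := measureReal_prod_eq_integral _ _ hB
  have hmsij : ∀ i j, MeasurableSet (g i • B ∩ g j • B) := fun i j =>
    (hB.const_smul _).inter (hB.const_smul _)
  have hsq : ∫ z, p z ^ 2 ∂(iotaMeasure η) ≤
      ∑ i, ∑ j, w i * w j * κ.real (g i • B ∩ g j • B) := by
    have hint : ∀ i j, Integrable (fun z => w i * w j *
        ν.real (Prod.mk z ⁻¹' (g i • B ∩ g j • B))) (iotaMeasure η) := fun i j =>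
      (integrable_measureReal_fibre _ _ (hmsij i j)).const_mul _
    calc ∫ z, p z ^ 2 ∂(iotaMeasure η)
        ≤ ∫ z, ∑ i, ∑ j, w i * w j * ν.real (Prod.mk z ⁻¹' (g i • B ∩ g j • B))
            ∂(iotaMeasure η) := by
          refine integral_mono hp2 (integrable_finsetSum _ fun i _ =>
            integrable_finsetSum _ fun j _ => hint i j) fun z => ?_
          simp only [Set.preimage_inter, prodMk_preimage_smul_trivial]
          exact sq_measureReal_le_weighted_sum (measurable_prodMk_left hB) g hw1
      _ = _ := by
          rw [integral_finsetSum _ fun i _ => integrable_finsetSum _ fun j _ => hint i j]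
          refine Finset.sum_congr rfl fun i _ => ?_
          rw [integral_finsetSum _ fun j _ => hint i j]
          refine Finset.sum_congr rfl fun j _ => ?_
          rw [integral_const_mul, measureReal_prod_eq_integral _ _ (hmsij i j)]
  have hκinv : ∀ γ : Γ, ∀ S, MeasurableSet S → κ.real (γ • S) = κ.real S := fun γ S hS => by
    rw [measureReal_prod_eq_integral _ _ (hS.const_smul γ), measureReal_prod_eq_integral _ _ hS]
    simp only [prodMk_preimage_smul_trivial, measureReal_def, measure_smul]
  have hcompare : ∑ i, ∑ j, w i * w j * κ.real (g i • B ∩ g j • B) ≤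
      ∑ i, ∑ j, w i * w j * μ.real (g i • A ∩ g j • A) + t := by
    have hij : ∀ i j, κ.real (g i • B ∩ g j • B) ≤ μ.real (g i • A ∩ g j • A) + t := by
      intro i j
      have h := (hB2 ((g j)⁻¹ * g i) (Finset.mem_union_right _
        (Finset.mem_image.2 ⟨(i, j), Finset.mem_univ _, rfl⟩))).1
      have e1 : g i • B ∩ g j • B = g j • (((g j)⁻¹ * g i) • B ∩ B) := by
        rw [Set.smul_set_inter, smul_smul, mul_inv_cancel_left]
      have e2 : g i • A ∩ g j • A = g j • (((g j)⁻¹ * g i) • A ∩ A) := by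
        rw [Set.smul_set_inter, smul_smul, mul_inv_cancel_left]
      rw [e1, hκinv _ _ ((hB.const_smul _).inter hB), e2, measureReal_def (μ := μ), measure_smul,
        ← measureReal_def]
      linarith [(abs_lt.1 h).1]
    calc _ ≤ ∑ i, ∑ j, w i * w j * (μ.real (g i • A ∩ g j • A) + t) := by
          refine Finset.sum_le_sum fun i _ => Finset.sum_le_sum fun j _ => ?_
          exact mul_le_mul_of_nonneg_left (hij i j) (mul_nonneg (hw i) (hw j))
      _ = _ := by
          simp only [mul_add, Finset.sum_add_distrib]
          congr 1
          simp only [← Finset.sum_mul, ← Finset.mul_sum, hw1, mul_one, one_mul]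
  have hfib := integral_fibre_mul_one_sub_le (η := η) hδ (by norm_num) hF hB
  have hsumF : ∑ γ ∈ F, κ.real ((γ • B) ∆ B) / δ ≤ 1 / 50 := by
    refine le_trans ?_ ht2
    rw [← nsmul_eq_mul]
    refine Finset.sum_le_card_nsmul _ _ _ fun γ hγ => ?_
    have h1 := (hA2 γ hγ).2
    have h2 := (hB2 γ (Finset.mem_union_left _ hγ)).2
    rw [hCinv, symmDiff_self, Set.bot_eq_empty, measureReal_empty] at h1
    rw [abs_lt] at h1 h2
    gcongr
    linarith
  have hsplit : ∫ z, p z * (1 - p z) ∂(iotaMeasure η) =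
      κ.real B - ∫ z, p z ^ 2 ∂(iotaMeasure η) := by
    rw [hκB, ← integral_sub hp hp2]
    congr with z
    ring
  rw [hsplit] at hfib
  rw [abs_lt] at hA1 hB1
  have hAsq : μ.real A ^ 2 ≤ (51 / 100) ^ 2 := by
    gcongr
    linarith
  -- Here `κ(B) > 0.48` and `∫ p² ≤ 0.51² + 0.01 + 0.01`, so `∫ p (1 - p) > 0.19`, against the upper
  -- bound `0.01 + 0.02`.
  linarith

/-! ### Cosines on the unit interval. -/

/-- The orthonormal cosine system of `L²([0,1])`. -/
noncomputable def cosineSystem (k : ℕ) : C(unitInterval, ℝ) where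
  toFun x := (if k = 0 then 1 else √2) * Real.cos (k * Real.pi * x)

theorem cosineSystem_apply (k : ℕ) (x : unitInterval) :
    cosineSystem k x = (if k = 0 then 1 else √2) * Real.cos (k * Real.pi * x) := rfl

@[simp]
theorem cosineSystem_zero : cosineSystem 0 = 1 := by
  ext x
  simp [cosineSystem_apply]

theorem integral_cos_int_mul_pi (n : ℤ) :
    ∫ x in (0 : ℝ)..1, Real.cos (n * Real.pi * x) = if n = 0 then 1 else 0 := by
  split_ifs with h
  · simp [h]
  · have hn : (n : ℝ) * Real.pi ≠ 0 := mul_ne_zero (Int.cast_ne_zero.2 h) Real.pi_ne_zero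
    rw [intervalIntegral.integral_comp_mul_left (fun x => Real.cos x) hn]
    simp [Real.sin_int_mul_pi]

theorem integral_unitInterval_eq (f : ℝ → ℝ) :
    ∫ x : unitInterval, f x = ∫ x in (0 : ℝ)..1, f x := by
  rw [intervalIntegral.integral_of_le zero_le_one, ← integral_Icc_eq_integral_Ioc]
  exact integral_subtype measurableSet_Icc f

theorem integral_cosineSystem_mul (j k : ℕ) :
    ∫ x, cosineSystem j x * cosineSystem k x = if j = k then 1 else 0 := by
  set a : ℝ := (if j = 0 then 1 else √2) * (if k = 0 then 1 else √2) with ha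
  have hpt : ∀ x : unitInterval, cosineSystem j x * cosineSystem k x =
      a / 2 * Real.cos (((j - k : ℤ) : ℝ) * Real.pi * x) +
        a / 2 * Real.cos (((j + k : ℤ) : ℝ) * Real.pi * x) := by
    intro x
    have h1 := Real.two_mul_cos_mul_cos (j * Real.pi * x) (k * Real.pi * x)
    rw [cosineSystem_apply, cosineSystem_apply, ha]
    push_cast
    have e1 : ((j : ℝ) - k) * Real.pi * x = j * Real.pi * x - k * Real.pi * x := by ring
    have e2 : ((j : ℝ) + k) * Real.pi * x = j * Real.pi * x + k * Real.pi * x := by ring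
    rw [e1, e2, ← mul_add, ← h1]
    ring
  simp_rw [hpt]
  rw [integral_unitInterval_eq (fun x => a / 2 * Real.cos (((j - k : ℤ) : ℝ) * Real.pi * x) +
        a / 2 * Real.cos (((j + k : ℤ) : ℝ) * Real.pi * x)),
    intervalIntegral.integral_add, intervalIntegral.integral_const_mul,
    intervalIntegral.integral_const_mul, integral_cos_int_mul_pi, integral_cos_int_mul_pi]
  · have h2 : √2 * √2 = 2 := Real.mul_self_sqrt zero_le_two
    by_cases hjk : j = k
    · subst hjk
      by_cases hj : j = 0
      · norm_num [ha, hj]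
      · have : ¬ ((j : ℤ) + j = 0) := by omega
        simp [ha, hj, h2, this]
    · have h3 : ¬ ((j : ℤ) - k = 0) := by omega
      have h4 : ¬ ((j : ℤ) + k = 0) := by omega
      simp [hjk, h3, h4]
  · exact Continuous.intervalIntegrable (by fun_prop) _ _
  · exact Continuous.intervalIntegrable (by fun_prop) _ _

/-- Product-to-sum formula. The cases `k = 0, 1` are separate because the constant function is
normalised by 1 instead of `√2`. This makes the span stable under multiplication by a function that
separates points. -/
theorem cosineSystem_one_mul_mem_span (k : ℕ) :
    cosineSystem 1 * cosineSystem k ∈ Submodule.span ℝ (Set.range cosineSystem) := by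
  have hmem : ∀ j, cosineSystem j ∈ Submodule.span ℝ (Set.range cosineSystem) := fun j =>
    Submodule.subset_span ⟨j, rfl⟩
  have hcos : ∀ x y : ℝ, Real.cos x * Real.cos y = (Real.cos (y - x) + Real.cos (y + x)) / 2 := by
    intro x y
    rw [Real.cos_sub, Real.cos_add]
    ring
  have h2 : √2 * √2 = 2 := Real.mul_self_sqrt zero_le_two
  rcases k with _ | _ | k
  · simpa using hmem 1
  · have : cosineSystem 1 * cosineSystem (0 + 1) =
        cosineSystem 0 + (√2 / 2) • cosineSystem 2 := by
      ext x
      simp only [ContinuousMap.mul_apply, ContinuousMap.add_apply, ContinuousMap.smul_apply,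
        cosineSystem_apply, smul_eq_mul]
      norm_num
      rw [show (2 : ℝ) * Real.pi * x = 2 * (Real.pi * x) by ring, Real.cos_two_mul]
      linear_combination h2 / 2
    rw [this]
    exact add_mem (hmem 0) (Submodule.smul_mem _ _ (hmem 2))
  · have : cosineSystem 1 * cosineSystem (k + 2) =
        (√2 / 2) • cosineSystem (k + 1) + (√2 / 2) • cosineSystem (k + 3) := by
      ext x
      simp only [ContinuousMap.mul_apply, ContinuousMap.add_apply, ContinuousMap.smul_apply,
        cosineSystem_apply, smul_eq_mul]
      have h := hcos ((1 : ℕ) * Real.pi * x) ((k + 2 : ℕ) * Real.pi * x)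
      rw [show ((k + 2 : ℕ) : ℝ) * Real.pi * x - (1 : ℕ) * Real.pi * x =
          ((k + 1 : ℕ) : ℝ) * Real.pi * x by push_cast; ring,
        show ((k + 2 : ℕ) : ℝ) * Real.pi * x + (1 : ℕ) * Real.pi * x =
          ((k + 3 : ℕ) : ℝ) * Real.pi * x by push_cast; ring] at h
      simp only [Nat.add_eq_zero_iff, OfNat.ofNat_ne_zero, one_ne_zero, and_false, if_false]
      linear_combination (√2 * √2) * h
    rw [this]
    exact add_mem (Submodule.smul_mem _ _ (hmem _)) (Submodule.smul_mem _ _ (hmem _))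

theorem cosineSystem_one_injective : Function.Injective (cosineSystem 1) := by
  intro x y h
  simp only [cosineSystem_apply, one_ne_zero, if_false, Nat.cast_one, one_mul] at h
  have h' := mul_left_cancel₀ (by positivity) h
  have hx : ∀ x : unitInterval, Real.pi * x ∈ Set.Icc 0 Real.pi := fun x =>
    ⟨mul_nonneg Real.pi_pos.le x.2.1, mul_le_of_le_one_right Real.pi_pos.le x.2.2⟩
  exact Subtype.ext (mul_left_cancel₀ Real.pi_ne_zero (Real.injOn_cos (hx x) (hx y) h'))

/-! ### A Hilbert basis of products of cosines. -/

section ProductSystem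

variable {G : Type*}

/-- The product functions `x ↦ ∏ g, cosineSystem (α g) (x g)` on `[0,1]^G`. -/
noncomputable def cosineProduct (α : G →₀ ℕ) : C(G → unitInterval, ℝ) :=
  α.prod fun g k => (cosineSystem k).comp (ContinuousMap.eval g)

theorem cosineProduct_apply (α : G →₀ ℕ) {W : Finset G} (hW : α.support ⊆ W)
    (x : G → unitInterval) : cosineProduct α x = ∏ g ∈ W, cosineSystem (α g) (x g) := by
  rw [cosineProduct, α.prod_of_support_subset hW _ (by intros; ext; simp), ContinuousMap.prod_apply]
  rfl

@[simp]
theorem cosineProduct_zero : cosineProduct (0 : G →₀ ℕ) = 1 := by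
  simp [cosineProduct]

theorem integral_infinitePi_prod (W : Finset G) (f : G → C(unitInterval, ℝ)) :
    ∫ x, ∏ g ∈ W, f g (x g) ∂(Measure.infinitePi fun _ : G => (volume : Measure unitInterval)) =
      ∏ g ∈ W, ∫ t, f g t := by
  have hind : ProbabilityTheory.iIndepFun (fun (g : W) (x : G → unitInterval) => x g)
      (Measure.infinitePi fun _ : G => (volume : Measure unitInterval)) :=
    .precomp (g := ((↑) : W → G)) Subtype.val_injective
      (ProbabilityTheory.iIndepFun_infinitePi (X := fun _ t => t) fun _ => measurable_id)
  have h := hind.integral_fun_prod_comp (f := fun g : W => f g)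
    (fun g => (measurable_pi_apply _).aemeasurable) (fun g => (by fun_prop))
  simp_rw [← Finset.prod_coe_sort W]
  rw [h]
  refine Finset.prod_congr rfl fun g _ => ?_
  have hm := measurePreserving_eval_infinitePi
    (fun _ : G => (volume : Measure unitInterval)) (g : G)
  have h2 := integral_map (μ := Measure.infinitePi fun _ : G => (volume : Measure unitInterval))
    hm.measurable.aemeasurable (f := f g) (by fun_prop)
  rw [hm.map_eq] at h2
  exact h2.symm

theorem integral_cosineProduct_mul [DecidableEq G] (α β : G →₀ ℕ) :
    ∫ x, cosineProduct α x * cosineProduct β x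
      ∂(Measure.infinitePi fun _ : G => (volume : Measure unitInterval)) =
      if α = β then 1 else 0 := by
  have h : ∀ x, cosineProduct α x * cosineProduct β x = ∏ g ∈ α.support ∪ β.support,
      (cosineSystem (α g) * cosineSystem (β g)) (x g) := fun x => by
    rw [cosineProduct_apply α Finset.subset_union_left,
      cosineProduct_apply β Finset.subset_union_right, ← Finset.prod_mul_distrib]
    rfl
  simp_rw [h]
  rw [integral_infinitePi_prod]
  simp only [ContinuousMap.mul_apply, integral_cosineSystem_mul]
  split_ifs with hαβ
  · simp [hαβ]
  · obtain ⟨g, hg⟩ := Finsupp.ne_iff.1 hαβ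
    refine Finset.prod_eq_zero (i := g) ?_ (if_neg hg)
    rw [Finset.mem_union, Finsupp.mem_support_iff, Finsupp.mem_support_iff]
    by_contra! h0
    exact hg (h0.1.trans h0.2.symm)

/-- Only the factor at `g` changes: with the others fixed, the product is linear in that factor, so
the one-variable statement carries over. -/
theorem cosineSystem_one_mul_cosineProduct_mem_span (g : G) (α : G →₀ ℕ) :
    (cosineSystem 1).comp (ContinuousMap.eval g) * cosineProduct α ∈
      Submodule.span ℝ (Set.range (cosineProduct (G := G))) := by
  classical
  have hupd : ∀ (β : G →₀ ℕ), cosineProduct β =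
      (cosineSystem (β g)).comp (ContinuousMap.eval g) * cosineProduct (β.erase g) := fun β =>
    (Finsupp.mul_prod_erase' β g _ (by intros; ext; simp)).symm
  let L : C(unitInterval, ℝ) →ₗ[ℝ] C(G → unitInterval, ℝ) :=
    { toFun := fun f => f.comp (ContinuousMap.eval g) * cosineProduct (α.erase g)
      map_add' := fun f f' => by ext; simp [add_mul]
      map_smul' := fun r f => by ext; simp }
  have hL : (Submodule.span ℝ (Set.range cosineSystem)).map L ≤
      Submodule.span ℝ (Set.range (cosineProduct (G := G))) := by
    rw [Submodule.map_span, Submodule.span_le]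
    rintro _ ⟨_, ⟨k, rfl⟩, rfl⟩
    refine Submodule.subset_span ⟨α.update g k, ?_⟩
    rw [hupd]
    simp [L]
  have := hL (Submodule.mem_map_of_mem (cosineSystem_one_mul_mem_span (α g)))
  convert this using 1
  rw [hupd α, ← mul_assoc]
  rfl

/-- Stone–Weierstrass: the span contains the algebra generated by the functions `cosineSystem 1 (x
g)`, multiplied in one at a time, and these separate points. -/
theorem span_cosineProduct_closure_eq_top :
    (Submodule.span ℝ (Set.range (cosineProduct (G := G)))).topologicalClosure = ⊤ := by
  let gens : Set C(G → unitInterval, ℝ) :=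
    Set.range fun g => (cosineSystem 1).comp (ContinuousMap.eval g)
  have hle : Subalgebra.toSubmodule (Algebra.adjoin ℝ gens) ≤
      Submodule.span ℝ (Set.range (cosineProduct (G := G))) := by
    rw [Algebra.adjoin_eq_span, Submodule.span_le]
    intro f hf
    induction hf using Submonoid.closure_induction_left with
    | one => exact Submodule.subset_span ⟨0, cosineProduct_zero⟩
    | mul_left f hf y _ ih =>
      obtain ⟨g, rfl⟩ := hf
      have hmap : (Submodule.span ℝ (Set.range (cosineProduct (G := G)))).map
          (LinearMap.mulLeft ℝ ((cosineSystem 1).comp (ContinuousMap.eval g))) ≤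
            Submodule.span ℝ (Set.range (cosineProduct (G := G))) := by
        rw [Submodule.map_span, Submodule.span_le]
        rintro _ ⟨_, ⟨α, rfl⟩, rfl⟩
        exact cosineSystem_one_mul_cosineProduct_mem_span g α
      exact hmap (Submodule.mem_map_of_mem ih)
  have hsep : (Algebra.adjoin ℝ gens).SeparatesPoints := by
    intro x y hxy
    obtain ⟨g, hg⟩ := Function.ne_iff.1 hxy
    exact ⟨_, ⟨_, Algebra.subset_adjoin ⟨g, rfl⟩, rfl⟩, cosineSystem_one_injective.ne hg⟩
  have htop := ContinuousMap.subalgebra_topologicalClosure_eq_top_of_separatesPoints _ hsep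
  refine top_le_iff.1 fun f _ => closure_mono hle ?_
  have : f ∈ (Algebra.adjoin ℝ gens).topologicalClosure := htop ▸ Algebra.mem_top
  exact this

variable [Countable G]

/-- The product functions, as elements of `L²([0,1]^G)`. -/
noncomputable def cosineProductLp (α : G →₀ ℕ) :
    Lp ℝ 2 (Measure.infinitePi fun _ : G => (volume : Measure unitInterval)) :=
  ContinuousMap.toLp 2 _ ℝ (cosineProduct α)

theorem orthonormal_cosineProductLp : Orthonormal ℝ (cosineProductLp (G := G)) := by
  classical
  rw [orthonormal_iff_ite]
  intro α β
  rw [cosineProductLp, cosineProductLp, ContinuousMap.inner_toLp, ← integral_cosineProduct_mul α β]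
  simp only [conj_trivial, mul_comm]

theorem span_cosineProductLp_closure_eq_top :
    (Submodule.span ℝ (Set.range (cosineProductLp (G := G)))).topologicalClosure = ⊤ := by
  have h := (ContinuousMap.toLp_denseRange ℝ
    (Measure.infinitePi fun _ : G => (volume : Measure unitInterval)) ℝ
    (p := 2) (by norm_num)).topologicalClosure_map_submodule
    (span_cosineProduct_closure_eq_top (G := G))
  rw [Submodule.map_span] at h
  rw [← h, ← Set.range_comp]
  rfl

/-- The Hilbert basis of `L²([0,1]^G)` given by products of cosines. -/
noncomputable def cosineBasis : HilbertBasis (G →₀ ℕ) ℝ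
    (Lp ℝ 2 (Measure.infinitePi fun _ : G => (volume : Measure unitInterval))) :=
  HilbertBasis.mk orthonormal_cosineProductLp span_cosineProductLp_closure_eq_top.ge

end ProductSystem

/-! ### The finitely additive measure attached to a set. -/

section FourierMass

variable {G : Type*}

instance (Γ : Type*) : IsProbabilityMeasure (bernoulliShiftMeasure Γ) :=
  inferInstanceAs (IsProbabilityMeasure
    (Measure.infinitePi fun _ : Γ => (volume : Measure unitInterval)))

/-- The proportion of the support of `α` that lies in `B`. -/
noncomputable def supportProportion (B : Set G) (α : G →₀ ℕ) : ℝ :=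
  (∑ g ∈ α.support, B.indicator 1 g) / α.support.card

theorem supportProportion_nonneg (B : Set G) (α : G →₀ ℕ) : 0 ≤ supportProportion B α :=
  div_nonneg (Finset.sum_nonneg fun _ _ => Set.indicator_nonneg (fun _ _ => zero_le_one) _)
    (Nat.cast_nonneg _)

theorem supportProportion_le_one (B : Set G) (α : G →₀ ℕ) : supportProportion B α ≤ 1 := by
  refine div_le_one_of_le₀ ?_ (Nat.cast_nonneg _)
  calc ∑ g ∈ α.support, B.indicator (1 : G → ℝ) g ≤ ∑ g ∈ α.support, (1 : ℝ) :=
        Finset.sum_le_sum fun g _ => Set.indicator_le_self' (fun _ _ => zero_le_one) g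
    _ = α.support.card := by simp

theorem supportProportion_univ {α : G →₀ ℕ} (hα : α ≠ 0) : supportProportion Set.univ α = 1 := by
  have : (α.support.card : ℝ) ≠ 0 := by simpa using hα
  simp [supportProportion, this]

-- The convention `0 / 0 = 0` removes the constant basis element, which has empty support.
@[simp]
theorem supportProportion_zero (B : Set G) : supportProportion B 0 = 0 := by
  simp [supportProportion]

theorem supportProportion_union {A B : Set G} (h : Disjoint A B) (α : G →₀ ℕ) :
    supportProportion (A ∪ B) α = supportProportion A α + supportProportion B α := by
  simp only [supportProportion, Set.indicator_union_of_disjoint h, Finset.sum_add_distrib, add_div]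

/-- The Fourier coefficients of the indicator function of `A` in the basis `cosineBasis`. -/
noncomputable def cosineCoeff (A : Set (BernoulliSpace G)) (α : G →₀ ℕ) : ℝ :=
  ∫ x in A, cosineProduct α x ∂(bernoulliShiftMeasure G)

/-- The mass that the Fourier transform of the indicator function of `A` gives to `B ⊆ G`, when
the mass of each nonconstant basis element is spread evenly over its support. -/
noncomputable def fourierMass (A : Set (BernoulliSpace G)) (B : Set G) : ℝ :=
  ∑' α, cosineCoeff A α ^ 2 * supportProportion B α

theorem fourierMass_nonneg (A : Set (BernoulliSpace G)) (B : Set G) : 0 ≤ fourierMass A B :=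
  tsum_nonneg fun α => mul_nonneg (sq_nonneg _) (supportProportion_nonneg B α)

variable [Countable G]

open scoped RealInnerProductSpace in
theorem cosineCoeff_eq_inner {A : Set (BernoulliSpace G)} (hA : MeasurableSet A) (α : G →₀ ℕ) :
    cosineCoeff A α = ⟪(indicatorConstLp 2 hA (measure_ne_top (bernoulliShiftMeasure G) _) (1 : ℝ) :
      Lp ℝ 2 (Measure.infinitePi fun _ : G => (volume : Measure unitInterval))),
      cosineBasis α⟫ := by
  rw [cosineBasis, HilbertBasis.coe_mk]
  refine Eq.trans ?_ (L2.inner_indicatorConstLp_one (𝕜 := ℝ) _ _ _).symm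
  refine setIntegral_congr_ae hA ?_
  filter_upwards [ContinuousMap.coeFn_toLp (p := 2) (𝕜 := ℝ)
    (Measure.infinitePi fun _ : G => (volume : Measure unitInterval)) (cosineProduct α)] with x hx _
  exact hx.symm

-- Parseval for `a 1_A + b 1_B`; the pairs `(1, 0)`, `(1, -1)` and `(1, 1)` are the ones needed.
open scoped RealInnerProductSpace in
theorem hasSum_linear_cosineCoeff {A B : Set (BernoulliSpace G)} (hA : MeasurableSet A)
    (hB : MeasurableSet B) (a b : ℝ) :
    HasSum (fun α => (a * cosineCoeff A α + b * cosineCoeff B α) ^ 2)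
      (a ^ 2 * (bernoulliShiftMeasure G).real A
        + 2 * a * b * (bernoulliShiftMeasure G).real (A ∩ B)
        + b ^ 2 * (bernoulliShiftMeasure G).real B) := by
  let ι : ∀ {S : Set (BernoulliSpace G)}, MeasurableSet S →
      Lp ℝ 2 (Measure.infinitePi fun _ : G => (volume : Measure unitInterval)) := fun hS =>
    indicatorConstLp 2 hS (measure_ne_top (bernoulliShiftMeasure G) _) (1 : ℝ)
  have hin : ∀ {S T : Set (BernoulliSpace G)} (hS : MeasurableSet S) (hT : MeasurableSet T),
      ⟪ι hS, ι hT⟫ = (bernoulliShiftMeasure G).real (S ∩ T) := fun hS hT =>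
    L2.real_inner_indicatorConstLp_one_indicatorConstLp_one _ _
  have h := cosineBasis.hasSum_inner_mul_inner (a • ι hA + b • ι hB) (a • ι hA + b • ι hB)
  have hval : ⟪a • ι hA + b • ι hB, a • ι hA + b • ι hB⟫ =
      a ^ 2 * (bernoulliShiftMeasure G).real A
        + 2 * a * b * (bernoulliShiftMeasure G).real (A ∩ B)
        + b ^ 2 * (bernoulliShiftMeasure G).real B := by
    simp only [inner_add_left, inner_add_right, real_inner_smul_left, real_inner_smul_right, hin,
      Set.inter_self, Set.inter_comm B A]
    ring
  have hterm : ∀ α, (a * cosineCoeff A α + b * cosineCoeff B α) ^ 2 =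
      ⟪a • ι hA + b • ι hB, cosineBasis α⟫ * ⟪cosineBasis α, a • ι hA + b • ι hB⟫ := fun α => by
    rw [real_inner_comm (a • ι hA + b • ι hB), inner_add_left, real_inner_smul_left,
      real_inner_smul_left, cosineCoeff_eq_inner hA, cosineCoeff_eq_inner hB, sq]
  simp only [hterm, ← hval]
  exact h

theorem hasSum_sq_cosineCoeff {A : Set (BernoulliSpace G)} (hA : MeasurableSet A) :
    HasSum (fun α => cosineCoeff A α ^ 2) ((bernoulliShiftMeasure G).real A) := by
  simpa using hasSum_linear_cosineCoeff hA hA 1 0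

theorem hasSum_sq_sub_cosineCoeff {A B : Set (BernoulliSpace G)} (hA : MeasurableSet A)
    (hB : MeasurableSet B) :
    HasSum (fun α => (cosineCoeff A α - cosineCoeff B α) ^ 2)
      ((bernoulliShiftMeasure G).real (A ∆ B)) := by
  have h := hasSum_linear_cosineCoeff hA hB 1 (-1)
  have h1 := measureReal_inter_add_sdiff (μ := bernoulliShiftMeasure G) (s := A) hB
  have h2 := measureReal_inter_add_sdiff (μ := bernoulliShiftMeasure G) (s := B) hA
  have h3 : (bernoulliShiftMeasure G).real (A ∆ B) = (bernoulliShiftMeasure G).real (A \ B) +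
      (bernoulliShiftMeasure G).real (B \ A) := by
    rw [Set.symmDiff_def, measureReal_union disjoint_sdiff_sdiff (hB.diff hA)]
  rw [Set.inter_comm B A] at h2
  have hval : (bernoulliShiftMeasure G).real (A ∆ B) =
      1 ^ 2 * (bernoulliShiftMeasure G).real A
        + 2 * 1 * (-1) * (bernoulliShiftMeasure G).real (A ∩ B)
        + (-1) ^ 2 * (bernoulliShiftMeasure G).real B := by linarith
  rw [hval]
  convert h using 3
  ring

theorem summable_fourierMass {A : Set (BernoulliSpace G)} (hA : MeasurableSet A) (B : Set G) :
    Summable fun α => cosineCoeff A α ^ 2 * supportProportion B α :=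
  (hasSum_sq_cosineCoeff hA).summable.of_nonneg_of_le
    (fun α => mul_nonneg (sq_nonneg _) (supportProportion_nonneg B α))
    fun α => mul_le_of_le_one_right (sq_nonneg _) (supportProportion_le_one B α)

theorem fourierMass_union {A : Set (BernoulliSpace G)} (hA : MeasurableSet A) {B C : Set G}
    (h : Disjoint B C) : fourierMass A (B ∪ C) = fourierMass A B + fourierMass A C := by
  simp only [fourierMass, supportProportion_union h, mul_add]
  exact (summable_fourierMass hA B).tsum_add (summable_fourierMass hA C)

/-- The total is Parseval's sum without the constant term, whose coefficient is `μ(A)`. -/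
theorem fourierMass_univ {A : Set (BernoulliSpace G)} (hA : MeasurableSet A) :
    fourierMass A Set.univ =
      (bernoulliShiftMeasure G).real A * (1 - (bernoulliShiftMeasure G).real A) := by
  classical
  have h0 : cosineCoeff A (0 : G →₀ ℕ) = (bernoulliShiftMeasure G).real A := by
    rw [cosineCoeff, cosineProduct_zero]
    change ∫ x in A, (1 : ℝ) ∂(bernoulliShiftMeasure G) = _
    rw [setIntegral_const, smul_eq_mul, mul_one]
  have h := hasSum_ite_sub_hasSum (hasSum_sq_cosineCoeff hA) 0
  rw [h0] at h
  rw [mul_sub, mul_one, ← sq, ← h.tsum_eq, fourierMass]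
  refine tsum_congr fun α => ?_
  split_ifs with hα
  · simp [hα]
  · rw [supportProportion_univ hα, mul_one]

/-- Factor the difference of squares and apply Cauchy–Schwarz: the differences have square sum `μ(A
∆ A')`, the sums at most `‖1_A + 1_A'‖² ≤ 4`. -/
theorem abs_fourierMass_sub_le {A A' : Set (BernoulliSpace G)} (hA : MeasurableSet A)
    (hA' : MeasurableSet A') (B : Set G) :
    |fourierMass A B - fourierMass A' B| ≤
      2 * √((bernoulliShiftMeasure G).real (A ∆ A')) := by
  set μ := bernoulliShiftMeasure G
  have hd := hasSum_sq_sub_cosineCoeff hA hA'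
  have hs := hasSum_linear_cosineCoeff hA hA' 1 1
  simp only [one_mul, one_pow, mul_one] at hs
  have hs4 : μ.real A + 2 * μ.real (A ∩ A') + μ.real A' ≤ 4 := by
    have h1 : μ.real A ≤ 1 := measureReal_le_one
    have h2 : μ.real A' ≤ 1 := measureReal_le_one
    have h3 : μ.real (A ∩ A') ≤ 1 := measureReal_le_one
    linarith
  have hsub : Summable fun α => cosineCoeff A α ^ 2 * supportProportion B α -
      cosineCoeff A' α ^ 2 * supportProportion B α :=
    (summable_fourierMass hA B).sub (summable_fourierMass hA' B)
  rw [fourierMass, fourierMass, ← (summable_fourierMass hA B).tsum_sub (summable_fourierMass hA' B)]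
  have hfin : ∀ s : Finset (G →₀ ℕ), |∑ α ∈ s, (cosineCoeff A α ^ 2 * supportProportion B α -
      cosineCoeff A' α ^ 2 * supportProportion B α)| ≤ 2 * √(μ.real (A ∆ A')) := by
    intro s
    calc |∑ α ∈ s, (cosineCoeff A α ^ 2 * supportProportion B α -
            cosineCoeff A' α ^ 2 * supportProportion B α)|
        ≤ ∑ α ∈ s, |cosineCoeff A α - cosineCoeff A' α| * |cosineCoeff A α + cosineCoeff A' α| := by
          refine (Finset.abs_sum_le_sum_abs _ _).trans (Finset.sum_le_sum fun α _ => ?_)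
          rw [← sub_mul, sq_sub_sq, abs_mul, abs_mul, mul_comm |_ + _|]
          refine mul_le_of_le_one_right (by positivity) ?_
          rw [abs_of_nonneg (supportProportion_nonneg _ _)]
          exact supportProportion_le_one _ _
      _ ≤ √(∑ α ∈ s, |cosineCoeff A α - cosineCoeff A' α| ^ 2) *
            √(∑ α ∈ s, |cosineCoeff A α + cosineCoeff A' α| ^ 2) :=
          Real.sum_mul_le_sqrt_mul_sqrt _ _ _
      _ ≤ √(μ.real (A ∆ A')) * √4 := by
          simp only [sq_abs]
          gcongr
          · exact sum_le_hasSum s (fun _ _ => sq_nonneg _) hd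
          · exact (sum_le_hasSum s (fun _ _ => sq_nonneg _) hs).trans hs4
      _ = 2 * √(μ.real (A ∆ A')) := by
          rw [show (4 : ℝ) = 2 ^ 2 by norm_num, Real.sqrt_sq zero_le_two, mul_comm]
  exact le_of_tendsto hsub.hasSum.abs (.of_forall hfin)

end FourierMass

/-! ### Equivariance and strong ergodicity of the Bernoulli shift. -/

section Shift

variable {Γ : Type*} [Group Γ]

theorem bernoulliSpace_smul_apply (γ : Γ) (x : BernoulliSpace Γ) (δ : Γ) :
    (γ • x) δ = x (γ⁻¹ * δ) := rfl

instance : MeasurableConstSMul Γ (BernoulliSpace Γ) where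
  measurable_const_smul γ :=
    measurable_pi_iff.2 fun δ => measurable_pi_apply (X := fun _ : Γ => unitInterval) (γ⁻¹ * δ)

theorem measurePreserving_smul_bernoulli (γ : Γ) :
    MeasurePreserving (fun x : BernoulliSpace Γ => γ • x) (bernoulliShiftMeasure Γ)
      (bernoulliShiftMeasure Γ) :=
  ⟨measurable_const_smul γ, Measure.map_infinitePi_infinitePi_of_inj
    (P := fun _ : Γ => (volume : Measure unitInterval)) (mul_right_injective γ⁻¹)⟩

instance : SMulInvariantMeasure Γ (BernoulliSpace Γ) (bernoulliShiftMeasure Γ) where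
  measure_preimage_smul γ _ hs :=
    (measurePreserving_smul_bernoulli γ).measure_preimage hs.nullMeasurableSet

theorem supportProportion_translate (γ : Γ) (B : Set Γ) (α : Γ →₀ ℕ) :
    supportProportion (γ • B) (α.equivMapDomain (Equiv.mulLeft γ)) = supportProportion B α := by
  have hsupp : (α.equivMapDomain (Equiv.mulLeft γ)).support =
      α.support.map (Equiv.mulLeft γ).toEmbedding := rfl
  simp only [supportProportion, hsupp, Finset.sum_map, Finset.card_map]
  congr 1
  refine Finset.sum_congr rfl fun g _ => ?_
  by_cases hg : g ∈ B
  · rw [Set.indicator_of_mem hg, Set.indicator_of_mem]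
    exacts [rfl, Set.smul_mem_smul_set hg]
  · rw [Set.indicator_of_notMem hg, Set.indicator_of_notMem]
    exact fun h => hg (Set.smul_mem_smul_set_iff.1 h)

theorem cosineProduct_translate (γ : Γ) (α : Γ →₀ ℕ) (x : BernoulliSpace Γ) :
    cosineProduct (α.equivMapDomain (Equiv.mulLeft γ)) (γ • x) = cosineProduct α x := by
  refine (cosineProduct_apply _ subset_rfl _).trans
    (Eq.trans ?_ (cosineProduct_apply α subset_rfl x).symm)
  refine (Finset.prod_map α.support (Equiv.mulLeft γ).toEmbedding _).trans
    (Finset.prod_congr rfl fun g _ => ?_)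
  simp only [Equiv.coe_toEmbedding, Finsupp.equivMapDomain_apply,
    Equiv.mulLeft_symm, Equiv.coe_mulLeft, bernoulliSpace_smul_apply, inv_mul_cancel_left]

theorem cosineCoeff_translate (γ : Γ) (A : Set (BernoulliSpace Γ)) (α : Γ →₀ ℕ) :
    cosineCoeff (γ • A) (α.equivMapDomain (Equiv.mulLeft γ)) = cosineCoeff A α := by
  have h := (measurePreserving_smul_bernoulli γ).setIntegral_image_emb
    (MeasurableEquiv.smul γ).measurableEmbedding
    (cosineProduct (α.equivMapDomain (Equiv.mulLeft γ))) A
  simp only [cosineProduct_translate] at h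
  exact h

/-- The shift permutes the basis by translating supports, so the sum is merely reindexed. -/
theorem fourierMass_translate (γ : Γ) (A : Set (BernoulliSpace Γ)) (B : Set Γ) :
    fourierMass (γ • A) (γ • B) = fourierMass A B := by
  let e : (Γ →₀ ℕ) ≃ (Γ →₀ ℕ) := (Finsupp.domCongr (Equiv.mulLeft γ)).toEquiv
  rw [fourierMass, ← e.tsum_eq]
  refine tsum_congr fun α => ?_
  change cosineCoeff (γ • A) (α.equivMapDomain (Equiv.mulLeft γ)) ^ 2 *
    supportProportion (γ • B) (α.equivMapDomain (Equiv.mulLeft γ)) = _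
  rw [cosineCoeff_translate, supportProportion_translate]

variable [Countable Γ]

/-- The Bernoulli shift of a non-amenable group is strongly ergodic. -/
theorem isStronglyErgodic_bernoulliShift (hΓ : ¬ IsAmenableGroup Γ) :
    IsStronglyErgodic Γ (bernoulliShiftMeasure Γ) := by
  intro A hA hinv
  set μ := bernoulliShiftMeasure Γ
  by_contra hlim
  apply hΓ
  set q : ℕ → ℝ := fun n => μ.real (A n) * (1 - μ.real (A n))
  have hq0 : ∀ n, 0 ≤ q n := fun n =>
    mul_nonneg measureReal_nonneg (sub_nonneg.2 measureReal_le_one)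
  obtain ⟨c, hc, hfreq⟩ : ∃ c > 0, ∃ᶠ n in atTop, c ≤ q n := by
    by_contra! hcon
    refine hlim (tendsto_order.2 ⟨fun a ha => .of_forall fun n => ha.trans_le (hq0 n),
      fun a ha => ?_⟩)
    simpa [not_frequently] using hcon a ha
  have hne : (atTop ⊓ 𝓟 {n | c ≤ q n}).NeBot := frequently_mem_iff_neBot.1 hfreq
  -- The ultrafilter lives on the indices with `q n ≥ c`, where normalising by `q n` is harmless.
  let U : Ultrafilter ℕ := Ultrafilter.of (atTop ⊓ 𝓟 {n | c ≤ q n})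
  have hUle : (U : Filter ℕ) ≤ atTop ⊓ 𝓟 {n | c ≤ q n} := Ultrafilter.of_le _
  have hUtop : (U : Filter ℕ) ≤ atTop := hUle.trans inf_le_left
  have hUc : ∀ᶠ n in (U : Filter ℕ), c ≤ q n :=
    (hUle.trans inf_le_right) (mem_principal_self _)
  let m : ℕ → Set Γ → ℝ := fun n B => fourierMass (A n) B / q n
  have hm0 : ∀ n B, 0 ≤ m n B := fun n B => div_nonneg (fourierMass_nonneg _ _) (hq0 n)
  have hm1 : ∀ n B, m n B ≤ 1 := fun n B => by
    refine div_le_one_of_le₀ ?_ (hq0 n)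
    have h := fourierMass_union (hA n) (B := B) (C := Bᶜ) disjoint_compl_right
    rw [Set.union_compl_self, fourierMass_univ (hA n)] at h
    have := fourierMass_nonneg (A n) Bᶜ
    linarith
  have hlimit : ∀ B, ∃ a, Tendsto (fun n => m n B) U (𝓝 a) := fun B => by
    obtain ⟨a, -, ha⟩ := (isCompact_Icc (a := (0 : ℝ)) (b := 1)).ultrafilter_le_nhds
      (U.map fun n => m n B) (le_principal_iff.2
        (Ultrafilter.mem_map.2 (Eventually.of_forall fun n => ⟨hm0 n B, hm1 n B⟩)))
    exact ⟨a, ha⟩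
  choose M hM using hlimit
  refine ⟨M, fun B => ge_of_tendsto' (hM B) fun n => hm0 n B, ?_, fun B C hBC => ?_,
    fun γ B => ?_⟩
  · refine tendsto_nhds_unique (hM _) (tendsto_const_nhds.congr' ?_)
    filter_upwards [hUc] with n hn
    simp only [m, fourierMass_univ (hA n)]
    exact (div_self (hc.trans_le hn).ne').symm
  · refine tendsto_nhds_unique (hM _) (((hM B).add (hM C)).congr fun n => ?_)
    simp only [m, fourierMass_union (hA n) hBC, add_div]
  · have hzero : Tendsto (fun n => m n (γ • B) - m n B) U (𝓝 0) := by
      have hb : Tendsto (fun n => 2 * √(μ.real ((γ • A n) ∆ A n)) / c) U (𝓝 0) := by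
        have := (((hinv γ).mono_left hUtop).sqrt.const_mul 2).div_const c
        simpa using this
      refine squeeze_zero_norm' ?_ hb
      filter_upwards [hUc] with n hn
      simp only [m]
      rw [← sub_div, norm_div, Real.norm_eq_abs, Real.norm_eq_abs, abs_of_nonneg (hq0 n)]
      refine div_le_div₀ (by positivity) ?_ hc hn
      -- By equivariance, `m n B` is the normalised mass that `γ • A n` gives to `γ • B`, so both
      -- masses are evaluated on the same set `γ • B`.
      have h := abs_fourierMass_sub_le ((hA n).const_smul γ) (hA n) (γ • B)
      rwa [fourierMass_translate, abs_sub_comm] at h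
    have := tendsto_nhds_unique hzero ((hM (γ • B)).sub (hM B))
    linarith

end Shift

/-! ### Freeness, and the theorem. -/

instance (Z : Type*) [MeasurableSpace Z] [StandardBorelSpace Z] :
    StandardBorelSpace (TrivialActionSpace Z) := inferInstanceAs (StandardBorelSpace Z)

instance (Γ : Type*) [Countable Γ] : StandardBorelSpace (BernoulliSpace Γ) :=
  inferInstanceAs (StandardBorelSpace (Γ → unitInterval))

theorem isMPAction_bernoulliShift (Γ : Type*) [Group Γ] [Countable Γ] :
    IsMPAction Γ (bernoulliShiftMeasure Γ) :=
  ⟨inferInstance, inferInstance, inferInstance, inferInstance⟩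

theorem IsMPAction.iota_prod {Γ : Type*} [Group Γ] {Z : Type*} [MeasurableSpace Z]
    [StandardBorelSpace Z] (η : Measure Z) [IsProbabilityMeasure η] {Y : Type*}
    [MeasurableSpace Y] [MulAction Γ Y] {ν : Measure Y} (h : IsMPAction Γ ν) :
    IsMPAction Γ ((iotaMeasure η).prod ν) := by
  have := h.standardBorelSpace
  have := h.isProbabilityMeasure
  have := h.measurableConstSMul
  have := h.smulInvariantMeasure
  refine ⟨inferInstance, inferInstance, inferInstance, ⟨fun γ s hs => ?_⟩⟩
  exact ((MeasurePreserving.id (iotaMeasure η)).prod (measurePreserving_smul γ ν)).measure_preimage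
    hs.nullMeasurableSet

/-- A point fixed by `γ` has equal coordinates at `1` and `γ⁻¹`; these are independent and uniform,
and the diagonal of the square is null. -/
theorem isFreeAction_bernoulliShift (Γ : Type*) [Group Γ] :
    IsFreeAction Γ (bernoulliShiftMeasure Γ) := by
  intro γ hγ
  have hne : γ⁻¹ ≠ 1 := inv_ne_one.2 hγ
  have hmap := Measure.infinitePi_map_eval_prod
    (P := fun _ : Γ => (volume : Measure unitInterval)) hne
  have hdiag : ∀ᵐ p ∂((volume : Measure unitInterval).prod volume), p.1 ≠ p.2 := by
    refine (Measure.ae_prod_iff_ae_ae (p := fun p : unitInterval × unitInterval => p.1 ≠ p.2)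
      (measurableSet_eq_fun measurable_fst measurable_snd).compl).2 (.of_forall fun x => ?_)
    have : ∀ᵐ y ∂(volume : Measure unitInterval), y ≠ x := by
      simp [ae_iff]
    filter_upwards [this] with y hy using hy.symm
  rw [← hmap] at hdiag
  have h := ae_of_ae_map (by fun_prop) hdiag
  filter_upwards [h] with x hx hfix
  refine hx ?_
  have h1 := congrFun hfix (1 : Γ)
  rwa [bernoulliSpace_smul_apply, mul_one] at h1

theorem IsFreeAction.iota_prod {Γ : Type*} [Group Γ] {Z : Type*} [MeasurableSpace Z]
    (η : Measure Z) [IsProbabilityMeasure η] {Y : Type*} [MeasurableSpace Y] [MulAction Γ Y]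
    {ν : Measure Y} [IsProbabilityMeasure ν] (h : IsFreeAction Γ ν) :
    IsFreeAction Γ ((iotaMeasure η).prod ν) := by
  intro γ hγ
  filter_upwards [Measure.quasiMeasurePreserving_snd.ae (h γ hγ)] with p hp hfix
  exact hp (congrArg Prod.snd hfix)

theorem theorem1p3 (Γ : Type*) [Group Γ] [Countable Γ]
    (Z : Type*) [MeasurableSpace Z] [StandardBorelSpace Z]
    (η : Measure Z) [IsProbabilityMeasure η] [NullSingletonClass η] :
    (∀ (Y : Type*) [MeasurableSpace Y] [MulAction Γ Y] (ν : Measure Y),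
      IsMPAction Γ ν → IsStronglyErgodic Γ ν →
      ∀ (X : Type*) [MeasurableSpace X] [MulAction Γ X] (μ : Measure X),
        IsMPAction Γ μ → ErgodicSMul Γ X μ →
        ¬ WeaklyEquivalent Γ ((iotaMeasure η).prod ν) μ) ∧
    (¬ IsAmenableGroup Γ →
      IsMPAction Γ ((iotaMeasure η).prod (bernoulliShiftMeasure Γ)) ∧
      IsFreeAction Γ ((iotaMeasure η).prod (bernoulliShiftMeasure Γ)) ∧
      ∀ (X : Type*) [MeasurableSpace X] [MulAction Γ X] (μ : Measure X),
        IsMPAction Γ μ → ErgodicSMul Γ X μ →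
        ¬ WeaklyEquivalent Γ ((iotaMeasure η).prod (bernoulliShiftMeasure Γ)) μ) := by
  refine ⟨fun Y _ _ ν hν hse X _ _ μ hμ herg =>
    not_weaklyEquivalent_of_isStronglyErgodic η hν hse hμ herg, fun hΓ =>
    ⟨(isMPAction_bernoulliShift Γ).iota_prod η, (isFreeAction_bernoulliShift Γ).iota_prod η,
      fun X _ _ μ hμ herg => ?_⟩⟩
  exact not_weaklyEquivalent_of_isStronglyErgodic η (isMPAction_bernoulliShift Γ)
    (isStronglyErgodic_bernoulliShift hΓ) hμ herg
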